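/- Let $n\ge 0$ and let $S^{2n}\subset\mathbb R^{2n+1}$ be the round unit sphere. Let $SP^2(S^{2n})=(S^{2n}\times S^{2n})/\big((x,y)\sim(y,x)\big)$ be the space of unordered pairs $\{x,y\}$ of points of $S^{2n}$ ($x=y$ allowed), with the quotient topology and with the quotient of the Riemannian product metric on $S^{2n}\times S^{2n}$, that is, $$d(\{x,y\},\{x',y'\})=\min\Big(\sqrt{\theta(x,x')^2+\theta(y,y')^2},\ \sqrt{\theta(x,y')^2+\theta(y,x')^2}\Big),$$ where $\theta$ is the geodesic distance on $S^{2n}$. Put $$\mathcal D=\{\{x,x\}: x\in S^{2n}\},\qquad \tilde{\mathcal D}=\{\{x,-x\}: x\in S^{2n}\},\qquad V=SP^2(S^{2n})\setminus\mathcal D,$$ and, for $\varepsilon>0$, let $U=U_\varepsilon$ be the set of points at $d$-distance less than $\varepsilon$ from $\mathcal D$. 1. For $\{x,y\}\in V$ and $0\le t\le\frac12$ the formula $$\rho_t(\{x,y\})=\left\{\frac{(1-t)x-ty}{\|(1-t)x-ty\|},\ \frac{(1-t)y-tx}{\|(1-t)y-tx\|}\right\}$$ defines a homotopy $\rho_t:V\to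 V$, continuous in $(t,\{x,y\})$, with $\rho_0=\mathrm{id}$, $\rho_{1/2}(V)\subset\tilde{\mathcal D}$, and $\rho_t=\mathrm{id}$ on $\tilde{\mathcal D}$ for all $t$; so it is a deformation retraction of $V$ onto the set $\tilde{\mathcal D}$ of antipodal pairs. The map $\mathbb{RP}^{2n}\to V$ that sends the line through $x\in S^{2n}$ to $\{x,-x\}$ is a homotopy equivalence; in particular $V\simeq\mathbb{RP}^{2n}$. 2. There is $\varepsilon_0>0$ such that for all $0<\varepsilon<\varepsilon_0$ the map $S^{2n}\to U_\varepsilon$, $x\mapsto\{x,x\}$, is a homotopy equivalence (in particular $U_\varepsilon\simeq S^{2n}$), and $U_\varepsilon\cap V\simeq\mathbb P\,TS^{2n}$. Here $\mathbb P\,TS^{2n}$ is the projectivization of the tangent bundle of $S^{2n}$: the space of lines through the origin in the tangent spaces of $S^{2n}$, with the quotient topology from the nonzero tangent vectors. -/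

import Mathlib

open scoped Manifold ContDiff ContinuousMap LinearAlgebra.Projectivization

noncomputable section

/-- The unit sphere `S^d` in Euclidean space `ℝ^(d+1)`. -/
abbrev Sph (d : ℕ) : Type :=
  Metric.sphere (0 : EuclideanSpace ℝ (Fin (d + 1))) 1

/-- The second symmetric product `SP²(X)`, the space of unordered pairs `{x, y}` (with `x = y`
allowed), carries the quotient topology from `X × X`. -/
instance instTopologicalSpaceSymTwo (X : Type*) [TopologicalSpace X] :
    TopologicalSpace (Sym2 X) :=
  TopologicalSpace.coinduced (fun p : X × X => s(p.1, p.2)) inferInstance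

/-- Real projective space, the set of lines of a real topological vector space `E`, carries the
quotient topology from the nonzero vectors. -/
instance instTopologicalSpaceProjectivization (E : Type*) [AddCommGroup E] [Module ℝ E]
    [TopologicalSpace E] : TopologicalSpace (ℙ ℝ E) :=
  TopologicalSpace.coinduced (Projectivization.mk' ℝ) inferInstance

/-- Real projective space `ℝP^d`, the space of lines through the origin in `ℝ^(d+1)`. -/
abbrev RealProj (d : ℕ) : Type := ℙ ℝ (EuclideanSpace ℝ (Fin (d + 1)))

/-- The line through a point of the sphere. -/
def lineThrough {d : ℕ} (x : Sph d) : RealProj d :=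
  Projectivization.mk ℝ (x : EuclideanSpace ℝ (Fin (d + 1))) (ne_zero_of_mem_unit_sphere x)

section ProjectivizedTangentBundle

variable {H : Type*} [TopologicalSpace H] {E : Type*} [NormedAddCommGroup E] [NormedSpace ℝ E]
  (I : ModelWithCorners ℝ E H) (M : Type*) [TopologicalSpace M] [ChartedSpace H M]
  [IsManifold I 1 M]

/-- Nonzero tangent vectors `v`, `w` of `M` span the same line iff they have the same base point
and `w = c • v` for a nonzero real `c`. -/
def tangentLineSetoid : Setoid {v : TangentBundle I M // v.2 ≠ 0} where
  r v w := ∃ c : ℝˣ, (w : TangentBundle I M) = ⟨v.1.1, (c : ℝ) • v.1.2⟩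
  iseqv :=
    { refl := fun v => ⟨1, by simp⟩
      symm := by
        rintro ⟨v, hv⟩ ⟨w, hw⟩ ⟨c, hc⟩
        refine ⟨c⁻¹, ?_⟩
        dsimp only at hc ⊢
        subst hc
        simp [smul_smul]
      trans := by
        rintro ⟨u, hu⟩ ⟨v, hv⟩ ⟨w, hw⟩ ⟨c, hc⟩ ⟨d, hd⟩
        refine ⟨d * c, ?_⟩
        dsimp only at hc hd ⊢
        subst hc
        simpa [smul_smul] using hd }

/-- The projectivized tangent bundle `ℙTM`: the space of lines through the origin in the tangent
spaces of `M`, as a quotient of the complement of the zero section of `TM`. -/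
def ProjTangentBundle : Type _ := Quotient (tangentLineSetoid I M)

instance : TopologicalSpace (ProjTangentBundle I M) :=
  inferInstanceAs (TopologicalSpace (Quotient (tangentLineSetoid I M)))

end ProjectivizedTangentBundle

/-- The geodesic distance on the round unit sphere. -/
def sphDist {d : ℕ} (x y : Sph d) : ℝ :=
  InnerProductGeometry.angle (x : EuclideanSpace ℝ (Fin (d + 1))) y

/-- The distance of the Riemannian product `S^d × S^d` between `(x, y)` and `(x', y')`. -/
def prodDist {d : ℕ} (x y x' y' : Sph d) : ℝ :=
  √(sphDist x x' ^ 2 + sphDist y y' ^ 2)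

/-- The natural metric on `SP²(S^d)`: the quotient metric of the Riemannian product `S^d × S^d`
by the isometric flip `(x, y) ↦ (y, x)`. -/
def symDist {d : ℕ} (p q : Sym2 (Sph d)) : ℝ :=
  Sym2.lift₂ (⟨fun x y x' y' => min (prodDist x y x' y') (prodDist x y y' x'), by
    intro x y x' y'
    constructor
    · simp only [prodDist, add_comm (sphDist x _ ^ 2)]
      exact min_comm _ _
    · exact min_comm _ _⟩ :
    { f : Sph d → Sph d → Sph d → Sph d → ℝ //
      ∀ a₁ a₂ b₁ b₂, f a₁ a₂ b₁ b₂ = f a₂ a₁ b₁ b₂ ∧ f a₁ a₂ b₁ b₂ = f a₁ a₂ b₂ b₁ }) p q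

/-- The diagonal `{ {x, x} }` in `SP²(S^d)`. -/
def diagPairs (d : ℕ) : Set (Sym2 (Sph d)) := {p | ∃ x : Sph d, p = s(x, x)}

/-- The antipodal pairs `{ {x, -x} }` in `SP²(S^d)`. -/
def antipodalPairs (d : ℕ) : Set (Sym2 (Sph d)) := {p | ∃ x : Sph d, p = s(x, -x)}

/-- The open `ε`-tubular neighborhood of the diagonal in `SP²(S^d)`: the points at distance less
than `ε` from the diagonal in the natural metric. -/
def tubeNhd (d : ℕ) (ε : ℝ) : Set (Sym2 (Sph d)) :=
  {p | ∃ q ∈ diagPairs d, symDist p q < ε}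

/-- The complement of the diagonal in `SP²(S^d)`. -/
def offDiag (d : ℕ) : Set (Sym2 (Sph d)) := (diagPairs d)ᶜ

/-- `ρ t`, for `0 ≤ t ≤ T`, is a (strong) deformation retraction of `X` onto `A`. -/
structure IsDeformationRetraction {X : Type*} [TopologicalSpace X] (A : Set X) (T : ℝ)
    (ρ : ℝ → X → X) : Prop where
  continuousOn : ContinuousOn (fun z : ℝ × X => ρ z.1 z.2) (Set.Icc 0 T ×ˢ Set.univ)
  at_zero : ∀ x, ρ 0 x = x
  at_end : ∀ x, ρ T x ∈ A
  fixed : ∀ t ∈ Set.Icc 0 T, ∀ x ∈ A, ρ t x = x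

end

/-!
All statements hold for a sphere `S^d` of any dimension. Write an unordered pair of points of the
sphere as `{p + q, p - q}` with `p = (x + y) / 2` and `q = (x - y) / 2`. These two vectors are
orthogonal, `2 ‖p‖² = 1 + ⟪x, y⟫` and `2 ‖q‖² = 1 - ⟪x, y⟫`. All the homotopies are given by
`stretch α β`, which replaces the pair by the normalizations of `α p ± β q`; its effect on the
inner product `⟪x, y⟫` of the pair is explicit (`symInner_stretch`), so `homotopic_id_of_stretch`
reduces the existence of a homotopy on a set of pairs described by the inner product to an
inequality between real numbers. The three sets of the theorem are of this form: `V` is given by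
`⟪x, y⟫ < 1` (`offDiag_eq`), and `U_ε` by `⟪x, y⟫ > c` with `c = cos (√2 ε)` (`tubeNhd_eq`),
because the point of the diagonal nearest to `{x, y}` is the midpoint of `x` and `y`.

* On `V` the coefficients `(1 - 2 t, 1)` give the deformation onto the antipodal pairs, and an
  antipodal pair is the same as the line through `x - y`.
* On `U_ε` the coefficients `(1, 1 - t)` contract a pair to its midpoint.
* On `U_ε ∩ V` the vector `x - y` is nonzero and tangent to the sphere at the midpoint of `x` and
  `y`, so it spans a tangent line there. Conversely, a tangent line with base point `m` and unit
  direction `u` gives the pair with directions `m ± a u`, for a fixed small `a > 0`. Starting with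
  a tangent line, one gets it back; starting with a pair, one gets a pair with the same directions
  of `p` and `q`, which is joined to the original pair by a stretching.

For the last point the tangent bundle of the manifold `S^d` is compared with the pairs `(x, v)`,
`v ⟂ x`, of ambient vectors: the derivative of the inclusion (`ambientVec`) and the derivative of
the radial projection (`tangentOfAmbient`) are continuous and inverse to each other.

Maps and homotopies on sets of unordered pairs are continuous as soon as they are so on ordered
pairs, since `X × X → Sym2 X` is an open quotient map: openness passes to products and to
restrictions.
-/

noncomputable section

/-! ### Radial projection to the sphere -/

section Normalization

variable {d : ℕ}

/-- The ambient Euclidean space of `S^d`. -/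
abbrev Amb (d : ℕ) : Type := EuclideanSpace ℝ (Fin (d + 1))

/-- Radial projection `v ↦ v / ‖v‖` of the ambient space to the sphere; the origin is sent to an
arbitrary point. -/
def radial (v : Amb d) : Sph d :=
  if h : v = 0 then ⟨EuclideanSpace.single 0 1, by simp⟩
  else ⟨‖v‖⁻¹ • v, by simp [norm_smul, h]⟩

theorem coe_radial {v : Amb d} (h : v ≠ 0) : (radial v : Amb d) = ‖v‖⁻¹ • v := by
  simp [radial, h]

theorem norm_coe_sph (x : Sph d) : ‖(x : Amb d)‖ = 1 := norm_eq_of_mem_sphere x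

theorem coe_sph_ne_zero (x : Sph d) : (x : Amb d) ≠ 0 := ne_zero_of_mem_unit_sphere x

@[simp]
theorem radial_coe (x : Sph d) : radial (x : Amb d) = x := by
  apply Subtype.ext
  rw [coe_radial (coe_sph_ne_zero x), norm_coe_sph, inv_one, one_smul]

theorem radial_smul {c : ℝ} (hc : 0 < c) (v : Amb d) : radial (c • v) = radial v := by
  by_cases h : v = 0
  · simp [h]
  · apply Subtype.ext
    have hcv : c • v ≠ 0 := smul_ne_zero hc.ne' h
    rw [coe_radial hcv, coe_radial h, norm_smul, Real.norm_of_nonneg hc.le, mul_inv, smul_smul]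
    congr 1
    field_simp

theorem radial_neg {v : Amb d} (h : v ≠ 0) : radial (-v) = -radial v := by
  apply Subtype.ext
  rw [coe_neg_sphere, coe_radial h, coe_radial (neg_ne_zero.2 h), norm_neg, smul_neg]

theorem continuousAt_radial {v : Amb d} (h : v ≠ 0) : ContinuousAt (radial (d := d)) v := by
  rw [Topology.IsInducing.subtypeVal.continuousAt_iff]
  have hc : ContinuousAt (fun w : Amb d => ‖w‖⁻¹ • w) v :=
    (continuousAt_id.norm.inv₀ (norm_ne_zero_iff.2 h)).smul continuousAt_id
  refine hc.congr ?_
  filter_upwards [isOpen_ne.mem_nhds h] with w hw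
  exact (coe_radial hw).symm

theorem continuous_radial_comp {T : Type*} [TopologicalSpace T] {f : T → Amb d} (hf : Continuous f)
    (h : ∀ t, f t ≠ 0) : Continuous fun t => radial (f t) :=
  continuous_iff_continuousAt.2 fun t =>
    ContinuousAt.comp (f := f) (continuousAt_radial (h t)) hf.continuousAt

end Normalization

/-! ### The tangent bundle of the sphere -/

section TangentBundle

variable {d : ℕ}

theorem contMDiff_coe_sph :
    ContMDiff (𝓡 d) 𝓘(ℝ, Amb d) 1 ((↑) : Sph d → Amb d) :=
  have := Fact.mk (@finrank_euclideanSpace_fin ℝ _ (d + 1))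
  contMDiff_coe_sphere

/-- Radial projection is smooth away from the origin, as a map into the manifold `S^d`. -/
theorem contMDiffAt_radial {v : Amb d} (hv : v ≠ 0) :
    ContMDiffAt 𝓘(ℝ, Amb d) (𝓡 d) 1 (radial (d := d)) v := by
  have := Fact.mk (@finrank_euclideanSpace_fin ℝ _ (d + 1))
  rw [contMDiffAt_iff_target]
  refine ⟨continuousAt_radial hv, ContDiffAt.contMDiffAt ?_⟩
  set y : Sph d := radial v with hy
  -- In the stereographic chart at `y`, radial projection is an explicit smooth map.
  let U := (OrthonormalBasis.fromOrthogonalSpanSingleton (𝕜 := ℝ) d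
    (ne_zero_of_mem_unit_sphere (-y))).repr
  have hr : ContDiffAt ℝ 1 (fun w : Amb d => ‖w‖⁻¹ • w) v :=
    ((contDiffAt_id.norm ℝ hv).inv (norm_ne_zero_iff.2 hv)).smul contDiffAt_id
  have hrv : ‖v‖⁻¹ • v = (y : Amb d) := (coe_radial hv).symm
  have hopen : IsOpen {x : Amb d | innerSL ℝ ((-y : Sph d) : Amb d) x ≠ 1} :=
    isOpen_ne_fun (by fun_prop) continuous_const
  have hs : ContDiffAt ℝ 1 (stereoToFun ((-y : Sph d) : Amb d)) (‖v‖⁻¹ • v) := by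
    refine (contDiffOn_stereoToFun (n := 1)).contDiffAt (hopen.mem_nhds ?_)
    rw [hrv]
    simp only [Set.mem_ofPred_eq, coe_neg_sphere, innerSL_apply_apply, inner_neg_left,
      real_inner_self_eq_norm_sq, norm_coe_sph]
    norm_num
  have hU : ContDiffAt ℝ 1
      (fun w : Amb d => U (stereoToFun ((-y : Sph d) : Amb d) (‖w‖⁻¹ • w))) v :=
    U.contDiff.contDiffAt.comp v (ContDiffAt.comp (f := fun w : Amb d => ‖w‖⁻¹ • w) v hs hr)
  refine hU.congr_of_eventuallyEq ?_
  filter_upwards [isOpen_ne.mem_nhds hv] with w hw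
  simp only [Function.comp_apply, ← coe_radial hw]
  rfl

/-- The derivative of the inclusion `S^d ⊂ ℝ^(d+1)`: a tangent vector of the sphere, seen as a
vector of the ambient space. -/
def ambientVec (w : TangentBundle (𝓡 d) (Sph d)) : Amb d :=
  mvfderiv (𝓡 d) ((↑) : Sph d → Amb d) w.1 w.2

/-- The derivative of the radial projection at `x`, applied to an ambient vector. For `v ⟂ x` this
is `v`, seen as a tangent vector of the sphere at `x`. -/
def tangentOfAmbient (x : Sph d) (v : Amb d) : TangentBundle (𝓡 d) (Sph d) :=
  tangentMap 𝓘(ℝ, Amb d) (𝓡 d) (radial (d := d)) ⟨x, v⟩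

theorem tangentMap_coe_sph (w : TangentBundle (𝓡 d) (Sph d)) :
    tangentMap (𝓡 d) 𝓘(ℝ, Amb d) ((↑) : Sph d → Amb d) w = ⟨w.1, ambientVec w⟩ := rfl

/-- The chain rule for `radial ∘ (↑) = id`. -/
theorem tangentOfAmbient_ambientVec (w : TangentBundle (𝓡 d) (Sph d)) :
    tangentOfAmbient w.1 (ambientVec w) = w := by
  have h := tangentMap_comp_at (I := 𝓡 d) (I' := 𝓘(ℝ, Amb d)) (I'' := 𝓡 d)
    (f := ((↑) : Sph d → Amb d)) (g := radial) w
    ((contMDiffAt_radial (coe_sph_ne_zero w.1)).mdifferentiableAt one_ne_zero)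
    ((contMDiff_coe_sph w.1).mdifferentiableAt one_ne_zero)
  have hid : (radial ∘ ((↑) : Sph d → Amb d)) = id := funext radial_coe
  rw [hid, tangentMap_id, tangentMap_coe_sph] at h
  exact h.symm

theorem inner_ambientVec (w : TangentBundle (𝓡 d) (Sph d)) :
    inner ℝ (w.1 : Amb d) (ambientVec w) = 0 := by
  have := Fact.mk (@finrank_euclideanSpace_fin ℝ _ (d + 1))
  have h : ambientVec w ∈
      (mvfderiv (𝓡 d) ((↑) : Sph d → Amb d) w.1).range := ⟨w.2, rfl⟩
  rw [range_mvfderiv_subtypeVal] at h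
  exact Submodule.mem_orthogonal_singleton_iff_inner_right.1 h

theorem exists_ambientVec_eq {x : Sph d} {v : Amb d} (h : inner ℝ (x : Amb d) v = 0) :
    ∃ u : TangentSpace (𝓡 d) x, ambientVec ⟨x, u⟩ = v := by
  have := Fact.mk (@finrank_euclideanSpace_fin ℝ _ (d + 1))
  have h' : v ∈ (mvfderiv (𝓡 d) ((↑) : Sph d → Amb d) x).range := by
    rw [range_mvfderiv_subtypeVal]
    exact Submodule.mem_orthogonal_singleton_iff_inner_right.2 h
  exact h'

theorem tangentOfAmbient_proj (x : Sph d) (v : Amb d) : (tangentOfAmbient x v).1 = x :=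
  radial_coe x

theorem ambientVec_tangentOfAmbient {x : Sph d} {v : Amb d} (h : inner ℝ (x : Amb d) v = 0) :
    ambientVec (tangentOfAmbient x v) = v := by
  obtain ⟨u, rfl⟩ := exists_ambientVec_eq h
  rw [tangentOfAmbient_ambientVec ⟨x, u⟩]

theorem ambientVec_smul (x : Sph d) (c : ℝ) (u : TangentSpace (𝓡 d) x) :
    ambientVec ⟨x, c • u⟩ = c • ambientVec ⟨x, u⟩ :=
  (mvfderiv (𝓡 d) ((↑) : Sph d → Amb d) x).map_smul c u

theorem tangentOfAmbient_smul (x : Sph d) (c : ℝ) (v : Amb d) :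
    tangentOfAmbient x (c • v) =
      ⟨(tangentOfAmbient x v).1, c • (tangentOfAmbient x v).2⟩ := by
  refine congrArg (Bundle.TotalSpace.mk _)
    ((mfderiv 𝓘(ℝ, Amb d) (𝓡 d) (radial (d := d)) x).map_smul c v)

theorem ambientVec_ne_zero {w : TangentBundle (𝓡 d) (Sph d)} (h : w.2 ≠ 0) :
    ambientVec w ≠ 0 := by
  have := Fact.mk (@finrank_euclideanSpace_fin ℝ _ (d + 1))
  intro h0
  exact h (injective_mvfderiv_subtypeVal_sphere w.1 (h0.trans (map_zero _).symm))

theorem tangentOfAmbient_ne_zero {x : Sph d} {v : Amb d} (h : inner ℝ (x : Amb d) v = 0)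
    (hv : v ≠ 0) : (tangentOfAmbient x v).2 ≠ 0 := by
  intro h0
  apply hv
  rw [← ambientVec_tangentOfAmbient h, ambientVec, h0, map_zero]

theorem continuous_ambientVec : Continuous (ambientVec (d := d)) := by
  have h := (contMDiff_coe_sph (d := d)).continuous_tangentMap le_rfl
  have h2 := (tangentBundleModelSpaceHomeomorph 𝓘(ℝ, Amb d)).continuous.comp h
  exact continuous_snd.comp h2

theorem continuous_tangentOfAmbient {T : Type*} [TopologicalSpace T] {f : T → Sph d}
    {g : T → Amb d} (hf : Continuous f) (hg : Continuous g) :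
    Continuous fun t => tangentOfAmbient (f t) (g t) := by
  have hs : IsOpen {v : Amb d | v ≠ 0} := isOpen_ne
  have hr : ContMDiffOn 𝓘(ℝ, Amb d) (𝓡 d) 1 (radial (d := d))
      {v : Amb d | v ≠ 0} := fun v (hv : v ≠ 0) => (contMDiffAt_radial hv).contMDiffWithinAt
  have hc := hr.continuousOn_tangentMapWithin le_rfl hs.uniqueMDiffOn
  have hfg : Continuous fun t =>
      (⟨f t, g t⟩ : TangentBundle 𝓘(ℝ, Amb d) (Amb d)) := by
    have h2 : Continuous fun t => (((f t : Amb d), g t) : ModelProd (Amb d) (Amb d)) :=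
      (continuous_subtype_val.comp hf).prodMk hg
    exact (tangentBundleModelSpaceHomeomorph 𝓘(ℝ, Amb d)).symm.continuous.comp h2
  refine (hc.comp_continuous hfg fun t => coe_sph_ne_zero (f t)).congr fun t => ?_
  exact tangentMapWithin_eq_tangentMap (hs.uniqueMDiffOn _ (coe_sph_ne_zero (f t)))
    ((contMDiffAt_radial (coe_sph_ne_zero (f t))).mdifferentiableAt one_ne_zero)

end TangentBundle

/-! ### The topology of the symmetric square -/

section SymTwo

theorem sym2LiftOn_factors {X Z : Type*} (A : Set (Sym2 X)) (f : {z : X × X // s(z.1, z.2) ∈ A} → Z)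
    (hf : ∀ x y (h : s(x, y) ∈ A) (h' : s(y, x) ∈ A), f ⟨(x, y), h⟩ = f ⟨(y, x), h'⟩) :
    Function.FactorsThrough f (A.restrictPreimage fun p : X × X => s(p.1, p.2)) := by
  rintro ⟨⟨x, y⟩, h⟩ ⟨⟨x', y'⟩, h'⟩ e
  rcases Sym2.eq_iff.1 (congrArg Subtype.val e) with ⟨rfl, rfl⟩ | ⟨rfl, rfl⟩
  · rfl
  · exact hf _ _ _ _

variable {X Z : Type*} [TopologicalSpace X] [TopologicalSpace Z]

theorem isOpenQuotientMap_sym2Mk : IsOpenQuotientMap (fun p : X × X => s(p.1, p.2)) where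
  surjective := fun p => Sym2.ind (fun x y => ⟨(x, y), rfl⟩) p
  continuous := continuous_coinduced_rng
  isOpenMap := by
    intro U hU
    rw [isOpen_coinduced]
    have : (fun p : X × X => s(p.1, p.2)) ⁻¹' ((fun p : X × X => s(p.1, p.2)) '' U) =
        U ∪ Prod.swap ⁻¹' U := by
      ext ⟨x, y⟩
      simp only [Set.mem_preimage, Set.mem_image, Prod.exists, Set.mem_union, Prod.swap_prod_mk]
      constructor
      · rintro ⟨a, b, hab, h⟩
        rcases Sym2.eq_iff.1 h with ⟨rfl, rfl⟩ | ⟨rfl, rfl⟩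
        · exact Or.inl hab
        · exact Or.inr hab
      · rintro (h | h)
        · exact ⟨x, y, h, rfl⟩
        · exact ⟨y, x, h, Sym2.eq_swap⟩
    rw [this]
    exact hU.union (hU.preimage continuous_swap)

theorem continuous_sym2Mk {f g : Z → X} (hf : Continuous f) (hg : Continuous g) :
    Continuous fun z => s(f z, g z) :=
  isOpenQuotientMap_sym2Mk.continuous.comp (hf.prodMk hg)

theorem isQuotientMap_sym2Mk_restrictPreimage (A : Set (Sym2 X)) :
    Topology.IsQuotientMap (A.restrictPreimage fun p : X × X => s(p.1, p.2)) :=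
  IsOpenQuotientMap.isQuotientMap
    ⟨A.restrictPreimage_surjective isOpenQuotientMap_sym2Mk.surjective,
      isOpenQuotientMap_sym2Mk.continuous.restrictPreimage,
      isOpenQuotientMap_sym2Mk.isOpenMap.restrictPreimage A⟩

/-- A continuous symmetric function of the ordered pairs over a set `A` of unordered pairs descends
to a continuous map on `A`. -/
def sym2LiftOn (A : Set (Sym2 X)) (f : C({z : X × X // s(z.1, z.2) ∈ A}, Z))
    (hf : ∀ x y (h : s(x, y) ∈ A) (h' : s(y, x) ∈ A), f ⟨(x, y), h⟩ = f ⟨(y, x), h'⟩) : C(A, Z) :=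
  Topology.IsQuotientMap.lift
    (f := ⟨A.restrictPreimage fun p : X × X => s(p.1, p.2),
      isOpenQuotientMap_sym2Mk.continuous.restrictPreimage⟩)
    (isQuotientMap_sym2Mk_restrictPreimage A) f (sym2LiftOn_factors A f hf)

theorem sym2LiftOn_mk (A : Set (Sym2 X)) (f : C({z : X × X // s(z.1, z.2) ∈ A}, Z))
    (hf : ∀ x y (h : s(x, y) ∈ A) (h' : s(y, x) ∈ A), f ⟨(x, y), h⟩ = f ⟨(y, x), h'⟩)
    (x y : X) (h : s(x, y) ∈ A) : sym2LiftOn A f hf ⟨s(x, y), h⟩ = f ⟨(x, y), h⟩ :=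
  DFunLike.congr_fun (Topology.IsQuotientMap.lift_comp
    (f := ⟨A.restrictPreimage fun p : X × X => s(p.1, p.2),
      isOpenQuotientMap_sym2Mk.continuous.restrictPreimage⟩)
    (isQuotientMap_sym2Mk_restrictPreimage A) f (sym2LiftOn_factors A f hf))
    (⟨(x, y), h⟩ : {z : X × X // s(z.1, z.2) ∈ A})

end SymTwo

/-! ### Stretching pairs of points -/

section Stretch

variable {d : ℕ}

theorem add_ne_zero_of_orthogonal {p q : Amb d} (h : inner ℝ p q = 0)
    (hpq : 0 < ‖p‖ ^ 2 + ‖q‖ ^ 2) : p + q ≠ 0 := by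
  intro h0
  have := norm_add_sq_real p q
  rw [h0, h] at this
  simp at this
  linarith

theorem sub_ne_zero_of_orthogonal {p q : Amb d} (h : inner ℝ p q = 0)
    (hpq : 0 < ‖p‖ ^ 2 + ‖q‖ ^ 2) : p - q ≠ 0 := by
  rw [sub_eq_add_neg]
  exact add_ne_zero_of_orthogonal (by rw [inner_neg_right, h, neg_zero]) (by rwa [norm_neg])

theorem coe_radial_add {p q : Amb d} (h : inner ℝ p q = 0) (hpq : 0 < ‖p‖ ^ 2 + ‖q‖ ^ 2) :
    (radial (p + q) : Amb d) = (√(‖p‖ ^ 2 + ‖q‖ ^ 2))⁻¹ • (p + q) := by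
  rw [coe_radial (add_ne_zero_of_orthogonal h hpq)]
  congr 2
  rw [eq_comm, Real.sqrt_eq_iff_mul_self_eq_of_pos (norm_pos_iff.2
    (add_ne_zero_of_orthogonal h hpq)), ← sq, norm_add_sq_real, h]
  ring

theorem coe_radial_sub {p q : Amb d} (h : inner ℝ p q = 0) (hpq : 0 < ‖p‖ ^ 2 + ‖q‖ ^ 2) :
    (radial (p - q) : Amb d) = (√(‖p‖ ^ 2 + ‖q‖ ^ 2))⁻¹ • (p - q) := by
  have := coe_radial_add (p := p) (q := -q) (by rw [inner_neg_right, h, neg_zero])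
    (by rwa [norm_neg])
  rwa [norm_neg, ← sub_eq_add_neg] at this

theorem inner_radial_add_sub {p q : Amb d} (h : inner ℝ p q = 0)
    (hpq : 0 < ‖p‖ ^ 2 + ‖q‖ ^ 2) :
    inner ℝ (radial (p + q) : Amb d) (radial (p - q)) =
      (‖p‖ ^ 2 - ‖q‖ ^ 2) / (‖p‖ ^ 2 + ‖q‖ ^ 2) := by
  rw [coe_radial_add h hpq, coe_radial_sub h hpq, real_inner_smul_left, real_inner_smul_right,
    inner_add_left, inner_sub_right, inner_sub_right, real_inner_comm p q, h,
    real_inner_self_eq_norm_sq, real_inner_self_eq_norm_sq, ← mul_assoc, ← mul_inv,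
    Real.mul_self_sqrt hpq.le]
  ring

/-- The inner product `⟪x, y⟫`, as a function of the unordered pair `{x, y}` of points of `S^d`. -/
def symInner : Sym2 (Sph d) → ℝ :=
  Sym2.lift ⟨fun x y => inner ℝ (x : Amb d) y, fun _ _ => real_inner_comm _ _⟩

@[simp]
theorem symInner_mk (x y : Sph d) : symInner s(x, y) = inner ℝ (x : Amb d) y := rfl

theorem continuous_symInner : Continuous (symInner (d := d)) := by
  rw [isOpenQuotientMap_sym2Mk.continuous_comp_iff.symm]
  exact (continuous_subtype_val.comp continuous_fst).inner
    (continuous_subtype_val.comp continuous_snd)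

theorem inner_sph_mem (x y : Sph d) : inner ℝ (x : Amb d) y ∈ Set.Icc (-1 : ℝ) 1 := by
  have := abs_le.1 (abs_real_inner_le_norm (x : Amb d) y)
  rwa [norm_coe_sph, norm_coe_sph, mul_one] at this

theorem symInner_mem (p : Sym2 (Sph d)) : symInner p ∈ Set.Icc (-1 : ℝ) 1 :=
  Sym2.ind inner_sph_mem p

theorem inner_add_sub_sph (x y : Sph d) : inner ℝ ((x : Amb d) + y) ((x : Amb d) - y) = 0 := by
  rw [inner_add_left, inner_sub_right, inner_sub_right, real_inner_comm (x : Amb d) y,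
    real_inner_self_eq_norm_sq, real_inner_self_eq_norm_sq, norm_coe_sph, norm_coe_sph]
  ring

theorem norm_add_sph_sq (x y : Sph d) :
    ‖(x : Amb d) + y‖ ^ 2 = 2 + 2 * inner ℝ (x : Amb d) y := by
  rw [norm_add_sq_real, norm_coe_sph, norm_coe_sph]
  ring

theorem norm_sub_sph_sq (x y : Sph d) :
    ‖(x : Amb d) - y‖ ^ 2 = 2 - 2 * inner ℝ (x : Amb d) y := by
  rw [norm_sub_sq_real, norm_coe_sph, norm_coe_sph]
  ring

theorem add_sph_ne_zero {x y : Sph d} (h : -1 < inner ℝ (x : Amb d) y) : (x : Amb d) + y ≠ 0 := by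
  intro h0
  have := norm_add_sph_sq x y
  rw [h0, norm_zero] at this
  linarith

theorem sub_sph_ne_zero {x y : Sph d} (h : inner ℝ (x : Amb d) y < 1) : (x : Amb d) - y ≠ 0 := by
  intro h0
  have := norm_sub_sph_sq x y
  rw [h0, norm_zero] at this
  linarith

/-- Write a pair of points of the sphere as `{p + q, p - q}` with the orthogonal vectors
`p = (x + y) / 2`, `q = (x - y) / 2`. The stretched pair consists of the normalizations of
`α p + β q` and `α p - β q`; the factor `1 / 2`, which normalization cancels, is left out. -/
def stretch (α β : ℝ) : Sym2 (Sph d) → Sym2 (Sph d) :=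
  Sym2.lift ⟨fun x y =>
    s(radial (α • ((x : Amb d) + (y : Amb d)) + β • ((x : Amb d) - (y : Amb d))),
      radial (α • ((x : Amb d) + (y : Amb d)) - β • ((x : Amb d) - (y : Amb d)))), fun x y => by
    dsimp only
    rw [Sym2.eq_swap, add_comm (y : Amb d) x, ← neg_sub (x : Amb d) y, smul_neg, sub_neg_eq_add,
      ← sub_eq_add_neg]⟩

theorem stretch_mk (α β : ℝ) (x y : Sph d) : stretch α β s(x, y) =
    s(radial (α • ((x : Amb d) + (y : Amb d)) + β • ((x : Amb d) - (y : Amb d))),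
      radial (α • ((x : Amb d) + (y : Amb d)) - β • ((x : Amb d) - (y : Amb d)))) := rfl

/-- Half of the squared norm of the two vectors that `stretch α β` normalizes, for a pair of
points with inner product `s`. -/
def stretchDenom (α β s : ℝ) : ℝ := α ^ 2 * (1 + s) + β ^ 2 * (1 - s)

theorem inner_smul_add_sub_sph (α β : ℝ) (x y : Sph d) :
    inner ℝ (α • ((x : Amb d) + (y : Amb d))) (β • ((x : Amb d) - (y : Amb d))) = 0 := by
  rw [real_inner_smul_left, real_inner_smul_right, inner_add_sub_sph, mul_zero, mul_zero]

theorem norm_smul_add_sph_sq (α : ℝ) (x y : Sph d) :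
    ‖α • ((x : Amb d) + (y : Amb d))‖ ^ 2 = 2 * (α ^ 2 * (1 + inner ℝ (x : Amb d) y)) := by
  rw [norm_smul, mul_pow, norm_add_sph_sq, Real.norm_eq_abs, sq_abs]
  ring

theorem norm_smul_sub_sph_sq (β : ℝ) (x y : Sph d) :
    ‖β • ((x : Amb d) - (y : Amb d))‖ ^ 2 = 2 * (β ^ 2 * (1 - inner ℝ (x : Amb d) y)) := by
  rw [norm_smul, mul_pow, norm_sub_sph_sq, Real.norm_eq_abs, sq_abs]
  ring

theorem norm_sq_add_norm_sq_pos {α β : ℝ} {x y : Sph d}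
    (h : 0 < stretchDenom α β (inner ℝ (x : Amb d) y)) :
    0 < ‖α • ((x : Amb d) + (y : Amb d))‖ ^ 2 + ‖β • ((x : Amb d) - (y : Amb d))‖ ^ 2 := by
  rw [norm_smul_add_sph_sq, norm_smul_sub_sph_sq]
  rw [stretchDenom] at h
  linarith

theorem symInner_stretch {α β : ℝ} {p : Sym2 (Sph d)}
    (h : 0 < stretchDenom α β (symInner p)) :
    symInner (stretch α β p) =
      (α ^ 2 * (1 + symInner p) - β ^ 2 * (1 - symInner p)) / stretchDenom α β (symInner p) := by
  induction p using Sym2.ind with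
  | _ x y =>
    rw [stretch_mk, symInner_mk, inner_radial_add_sub (inner_smul_add_sub_sph α β x y)
      (norm_sq_add_norm_sq_pos h), norm_smul_add_sph_sq, norm_smul_sub_sph_sq, ← mul_sub,
      ← mul_add, mul_div_mul_left _ _ two_ne_zero]
    rfl

theorem continuousAt_stretch {α β : ℝ} {p : Sym2 (Sph d)}
    (h : 0 < stretchDenom α β (symInner p)) :
    ContinuousAt (fun z : ℝ × ℝ × Sym2 (Sph d) => stretch z.1 z.2.1 z.2.2) (α, β, p) := by
  induction p using Sym2.ind with
  | _ x y =>
    have hq : IsOpenQuotientMap (Prod.map (id : ℝ → ℝ) (Prod.map (id : ℝ → ℝ)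
        (fun p : Sph d × Sph d => s(p.1, p.2)))) :=
      IsOpenQuotientMap.id.prodMap (IsOpenQuotientMap.id.prodMap isOpenQuotientMap_sym2Mk)
    have hpos := norm_sq_add_norm_sq_pos h
    have horth := inner_smul_add_sub_sph α β x y
    refine (hq.continuousAt_comp_iff (x := (α, β, (x, y)))).1 ?_
    refine isOpenQuotientMap_sym2Mk.continuous.continuousAt.comp
      (f := fun z : ℝ × ℝ × (Sph d × Sph d) =>
        (radial (z.1 • ((z.2.2.1 : Amb d) + (z.2.2.2 : Amb d)) +
          z.2.1 • ((z.2.2.1 : Amb d) - (z.2.2.2 : Amb d))),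
         radial (z.1 • ((z.2.2.1 : Amb d) + (z.2.2.2 : Amb d)) -
          z.2.1 • ((z.2.2.1 : Amb d) - (z.2.2.2 : Amb d)))))
      (ContinuousAt.prodMk ?_ ?_)
    · exact ContinuousAt.comp (g := radial)
        (f := fun z : ℝ × ℝ × (Sph d × Sph d) =>
          z.1 • ((z.2.2.1 : Amb d) + (z.2.2.2 : Amb d)) +
            z.2.1 • ((z.2.2.1 : Amb d) - (z.2.2.2 : Amb d)))
        (continuousAt_radial (add_ne_zero_of_orthogonal horth hpos))
        (Continuous.continuousAt (by fun_prop))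
    · exact ContinuousAt.comp (g := radial)
        (f := fun z : ℝ × ℝ × (Sph d × Sph d) =>
          z.1 • ((z.2.2.1 : Amb d) + (z.2.2.2 : Amb d)) -
            z.2.1 • ((z.2.2.1 : Amb d) - (z.2.2.2 : Amb d)))
        (continuousAt_radial (sub_ne_zero_of_orthogonal horth hpos))
        (Continuous.continuousAt (by fun_prop))

theorem continuous_stretch {T : Type*} [TopologicalSpace T] {a b : T → ℝ} {p : T → Sym2 (Sph d)}
    (ha : Continuous a) (hb : Continuous b) (hp : Continuous p)
    (h : ∀ t, 0 < stretchDenom (a t) (b t) (symInner (p t))) :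
    Continuous fun t => stretch (a t) (b t) (p t) :=
  continuous_iff_continuousAt.2 fun t =>
    ContinuousAt.comp (f := fun t => (a t, b t, p t)) (continuousAt_stretch (h t))
      (ha.prodMk (hb.prodMk hp)).continuousAt

theorem stretch_one_one (p : Sym2 (Sph d)) : stretch 1 1 p = p := by
  induction p using Sym2.ind with
  | _ x y =>
    have h1 : (1 : ℝ) • ((x : Amb d) + (y : Amb d)) + (1 : ℝ) • ((x : Amb d) - (y : Amb d)) =
        (2 : ℝ) • (x : Amb d) := by module
    have h2 : (1 : ℝ) • ((x : Amb d) + (y : Amb d)) - (1 : ℝ) • ((x : Amb d) - (y : Amb d)) =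
        (2 : ℝ) • (y : Amb d) := by module
    rw [stretch_mk, h1, h2, radial_smul two_pos, radial_smul two_pos, radial_coe, radial_coe]

/-- Stretching by coefficients that vary continuously with the time and with the inner product of
the pair gives a homotopy starting at the identity, on any set of pairs that is described by a
condition `J` on the inner product and preserved by the stretchings. -/
theorem homotopic_id_of_stretch {J : Set ℝ} {a b : unitInterval × ℝ → ℝ}
    (ha : ContinuousOn a (Set.univ ×ˢ J)) (hb : ContinuousOn b (Set.univ ×ˢ J))
    (ha0 : ∀ s ∈ J, a (0, s) = 1) (hb0 : ∀ s ∈ J, b (0, s) = 1)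
    (hpos : ∀ t, ∀ s ∈ J, s ∈ Set.Icc (-1 : ℝ) 1 → 0 < stretchDenom (a (t, s)) (b (t, s)) s)
    (hmem : ∀ t, ∀ s ∈ J, s ∈ Set.Icc (-1 : ℝ) 1 →
      (a (t, s) ^ 2 * (1 + s) - b (t, s) ^ 2 * (1 - s)) /
        stretchDenom (a (t, s)) (b (t, s)) s ∈ J)
    (f : C(symInner (d := d) ⁻¹' J, symInner (d := d) ⁻¹' J))
    (hf : ∀ p, (f p : Sym2 (Sph d)) = stretch (a (1, symInner p.1)) (b (1, symInner p.1)) p.1) :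
    f.Homotopic (ContinuousMap.id _) := by
  have hc : Continuous fun z : unitInterval × (symInner (d := d) ⁻¹' J) =>
      ((z.1, symInner z.2.1) : unitInterval × ℝ) :=
    continuous_fst.prodMk (continuous_symInner.comp (continuous_subtype_val.comp continuous_snd))
  have hm : ∀ z : unitInterval × (symInner (d := d) ⁻¹' J),
      ((z.1, symInner z.2.1) : unitInterval × ℝ) ∈ (Set.univ ×ˢ J : Set (unitInterval × ℝ)) :=
    fun z => ⟨trivial, z.2.2⟩
  refine ContinuousMap.Homotopic.symm ⟨⟨⟨fun z =>
    ⟨stretch (a (z.1, symInner z.2.1)) (b (z.1, symInner z.2.1)) z.2.1, ?_⟩, ?_⟩, ?_, ?_⟩⟩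
  · rw [Set.mem_preimage, symInner_stretch (hpos _ _ z.2.2 (symInner_mem _))]
    exact hmem _ _ z.2.2 (symInner_mem _)
  · exact (continuous_stretch (ha.comp_continuous hc hm) (hb.comp_continuous hc hm)
      (continuous_subtype_val.comp continuous_snd)
      fun z => hpos _ _ z.2.2 (symInner_mem _)).subtype_mk _
  · intro p
    apply Subtype.ext
    change stretch (a (0, symInner p.1)) (b (0, symInner p.1)) p.1 = p.1
    rw [ha0 _ p.2, hb0 _ p.2, stretch_one_one]
  · intro p
    exact Subtype.ext (hf p).symm

end Stretch

/-! ### The sets of pairs in terms of the inner product -/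

section Neighborhoods

variable {d : ℕ}

theorem offDiag_eq : offDiag d = symInner ⁻¹' Set.Iio 1 := by
  ext p
  induction p using Sym2.ind with
  | _ x y =>
    have hle := (inner_sph_mem x y).2
    have h1 : inner ℝ (x : Amb d) y = 1 ↔ x = y := by
      rw [inner_eq_one_iff_of_norm_eq_one (norm_coe_sph x) (norm_coe_sph y), Subtype.ext_iff]
    have h2 : s(x, y) ∈ diagPairs d ↔ x = y := by
      constructor
      · rintro ⟨z, hz⟩
        rcases Sym2.eq_iff.1 hz with ⟨rfl, rfl⟩ | ⟨rfl, rfl⟩ <;> rfl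
      · rintro rfl
        exact ⟨x, rfl⟩
    rw [offDiag, Set.mem_compl_iff, h2, ← h1, Set.mem_preimage, symInner_mk, Set.mem_Iio]
    exact hle.lt_iff_ne.symm

theorem cos_sphDist (x y : Sph d) : Real.cos (sphDist x y) = inner ℝ (x : Amb d) y := by
  rw [sphDist, InnerProductGeometry.cos_angle, norm_coe_sph, norm_coe_sph, mul_one, div_one]

theorem sphDist_nonneg (x y : Sph d) : 0 ≤ sphDist x y := InnerProductGeometry.angle_nonneg _ _

theorem sphDist_le_pi (x y : Sph d) : sphDist x y ≤ Real.pi := InnerProductGeometry.angle_le_pi _ _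

theorem sphDist_comm (x y : Sph d) : sphDist x y = sphDist y x :=
  InnerProductGeometry.angle_comm _ _

theorem sphDist_triangle (x y z : Sph d) : sphDist x z ≤ sphDist x y + sphDist y z :=
  InnerProductGeometry.angle_le_angle_add_angle _ _ _

/-- The normalized sum of two points that are not antipodal is their midpoint. -/
theorem sphDist_midpoint {x y : Sph d} (h : -1 < inner ℝ (x : Amb d) y) :
    sphDist x (radial ((x : Amb d) + (y : Amb d))) = sphDist x y / 2 := by
  have hne := add_sph_ne_zero h
  have hN : 0 < ‖(x : Amb d) + (y : Amb d)‖ := norm_pos_iff.2 hne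
  have h0 := sphDist_nonneg x y
  have hpi := sphDist_le_pi x y
  refine Real.injOn_cos ⟨sphDist_nonneg _ _, sphDist_le_pi _ _⟩ ⟨by linarith, by linarith⟩ ?_
  rw [cos_sphDist, coe_radial hne, real_inner_smul_right, inner_add_right,
    real_inner_self_eq_norm_sq, norm_coe_sph, Real.cos_half (by linarith) hpi, cos_sphDist,
    eq_comm, Real.sqrt_eq_iff_mul_self_eq_of_pos]
  · have := norm_add_sph_sq x y
    have h2 : 1 + inner ℝ (x : Amb d) y = ‖(x : Amb d) + (y : Amb d)‖ ^ 2 / 2 := by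
      rw [this]; ring
    rw [one_pow, h2]
    field_simp
  · exact mul_pos (inv_pos.2 hN) (by rw [one_pow]; linarith)

theorem symDist_diag (x y z : Sph d) : symDist s(x, y) s(z, z) = prodDist x y z z :=
  min_self _

/-- A pair of points lies within distance `ε` of the diagonal iff the geodesic distance of the two
points is less than `√2 ε`; the nearest point of the diagonal is given by the midpoint. -/
theorem tubeNhd_eq {ε : ℝ} (h0 : 0 < ε) (h1 : √2 * ε ≤ Real.pi) :
    tubeNhd d ε = symInner ⁻¹' Set.Ioi (Real.cos (√2 * ε)) := by
  have h2 : (√2 * ε) ^ 2 = 2 * ε ^ 2 := by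
    rw [mul_pow, Real.sq_sqrt zero_le_two]
  have hpos : 0 < √2 * ε := by positivity
  ext p
  induction p using Sym2.ind with
  | _ x y =>
    rw [Set.mem_preimage, Set.mem_Ioi, symInner_mk]
    constructor
    · rintro ⟨_, ⟨z, rfl⟩, hz⟩
      rw [symDist_diag, prodDist, Real.sqrt_lt' h0] at hz
      have htri := sphDist_triangle x z y
      rw [sphDist_comm z y] at htri
      rw [← cos_sphDist]
      refine Real.cos_lt_cos_of_nonneg_of_le_pi (sphDist_nonneg _ _) h1 ?_
      refine htri.trans_lt (lt_of_pow_lt_pow_left₀ 2 hpos.le ?_)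
      nlinarith [sq_nonneg (sphDist x z - sphDist y z)]
    · intro hxy
      have hlt : sphDist x y < √2 * ε := by
        rw [← cos_sphDist] at hxy
        by_contra! hle
        exact absurd (Real.cos_le_cos_of_nonneg_of_le_pi hpos.le (sphDist_le_pi x y) hle)
          (not_le.2 hxy)
      have hne : -1 < inner ℝ (x : Amb d) y := (Real.neg_one_le_cos _).trans_lt hxy
      refine ⟨s(radial ((x : Amb d) + (y : Amb d)), radial ((x : Amb d) + (y : Amb d))),
        ⟨_, rfl⟩, ?_⟩
      have hy := sphDist_midpoint (x := y) (y := x) (by rwa [real_inner_comm])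
      rw [add_comm (y : Amb d) (x : Amb d), sphDist_comm y x] at hy
      rw [symDist_diag, prodDist, sphDist_midpoint hne, hy, Real.sqrt_lt' h0]
      have := pow_lt_pow_left₀ hlt (sphDist_nonneg x y) two_ne_zero
      nlinarith

end Neighborhoods

/-! ### Off-diagonal pairs and projective space -/

section OffDiagonal

variable {d : ℕ}

theorem stretchDenom_one_pos (α : ℝ) {s : ℝ} (hs : -1 ≤ s) (hs' : s < 1) :
    0 < stretchDenom α 1 s := by
  have : 0 ≤ α ^ 2 * (1 + s) := mul_nonneg (sq_nonneg _) (by linarith)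
  rw [stretchDenom]
  linarith

theorem stretch_one_quotient_lt_one (α : ℝ) {s : ℝ} (hs : -1 ≤ s) (hs' : s < 1) :
    (α ^ 2 * (1 + s) - 1 ^ 2 * (1 - s)) / stretchDenom α 1 s < 1 := by
  rw [div_lt_one (stretchDenom_one_pos α hs hs'), stretchDenom]
  linarith

theorem stretch_one_mem {p : Sym2 (Sph d)} (α : ℝ) (hp : symInner p < 1) :
    symInner (stretch α 1 p) < 1 := by
  rw [symInner_stretch (stretchDenom_one_pos α (symInner_mem p).1 hp)]
  exact stretch_one_quotient_lt_one α (symInner_mem p).1 hp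

theorem stretch_antipodal {α : ℝ} (β : ℝ) (x : Sph d) (hα : 0 < α) :
    stretch β α s(x, -x) = s(x, -x) := by
  have h1 : β • ((x : Amb d) + (-x : Amb d)) + α • ((x : Amb d) - (-x : Amb d)) =
      (2 * α) • (x : Amb d) := by module
  have h2 : β • ((x : Amb d) + (-x : Amb d)) - α • ((x : Amb d) - (-x : Amb d)) =
      (2 * α) • (-x : Amb d) := by module
  rw [stretch_mk, coe_neg_sphere, h1, h2, radial_smul (by positivity), radial_smul (by positivity),
    radial_coe, radial_neg (coe_sph_ne_zero x), radial_coe]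

theorem stretch_zero_one {x y : Sph d} (h : inner ℝ (x : Amb d) y < 1) :
    stretch 0 1 s(x, y) =
      s(radial ((x : Amb d) - (y : Amb d)), -radial ((x : Amb d) - (y : Amb d))) := by
  rw [stretch_mk, zero_smul, one_smul, zero_add, zero_sub, radial_neg (sub_sph_ne_zero h)]

/-- Away from the diagonal, the linear motion of the two points towards antipodal position is
`stretch` with coefficients `1 - 2 t` and `1`. -/
theorem stretch_one_eq (t : ℝ) (x y : Sph d) : stretch (1 - 2 * t) 1 s(x, y) =
    s(radial ((1 - t) • (x : Amb d) - t • (y : Amb d)),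
      radial ((1 - t) • (y : Amb d) - t • (x : Amb d))) := by
  have h1 : (1 - 2 * t) • ((x : Amb d) + (y : Amb d)) + (1 : ℝ) • ((x : Amb d) - (y : Amb d)) =
      (2 : ℝ) • ((1 - t) • (x : Amb d) - t • (y : Amb d)) := by module
  have h2 : (1 - 2 * t) • ((x : Amb d) + (y : Amb d)) - (1 : ℝ) • ((x : Amb d) - (y : Amb d)) =
      (2 : ℝ) • ((1 - t) • (y : Amb d) - t • (x : Amb d)) := by module
  rw [stretch_mk, h1, h2, radial_smul two_pos, radial_smul two_pos]

theorem smul_sub_smul_sph_ne_zero {x y : Sph d} (h : inner ℝ (x : Amb d) y < 1) (t : ℝ) :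
    (1 - t) • (x : Amb d) - t • (y : Amb d) ≠ 0 := by
  have h1 : (1 - 2 * t) • ((x : Amb d) + (y : Amb d)) + (1 : ℝ) • ((x : Amb d) - (y : Amb d)) =
      (2 : ℝ) • ((1 - t) • (x : Amb d) - t • (y : Amb d)) := by module
  have h2 := add_ne_zero_of_orthogonal (inner_smul_add_sub_sph (1 - 2 * t) 1 x y)
    (norm_sq_add_norm_sq_pos (stretchDenom_one_pos _ (inner_sph_mem x y).1 h))
  rw [h1] at h2
  exact (smul_ne_zero_iff.1 h2).2

/-- The deformation of the off-diagonal pairs onto the antipodal pairs, as a map that is defined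
for all real times. -/
def antipodalDeformation (t : ℝ) (p : offDiag d) : offDiag d :=
  ⟨stretch (1 - 2 * t) 1 p,
    offDiag_eq.symm.subset (stretch_one_mem _ (offDiag_eq.subset p.2))⟩

theorem isDeformationRetraction_antipodalDeformation :
    IsDeformationRetraction {p : offDiag d | p.1 ∈ antipodalPairs d} (1 / 2)
      antipodalDeformation where
  continuousOn := by
    refine Continuous.continuousOn (Continuous.subtype_mk (continuous_stretch (by fun_prop)
      continuous_const (by fun_prop) fun z => ?_) _)
    exact stretchDenom_one_pos _ (symInner_mem _).1 (offDiag_eq.subset z.2.2)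
  at_zero p := Subtype.ext (by
    change stretch (1 - 2 * 0) 1 p.1 = p.1
    rw [mul_zero, sub_zero, stretch_one_one])
  at_end := by
    rintro ⟨p, hp⟩
    induction p using Sym2.ind with
    | _ x y =>
      refine ⟨radial ((x : Amb d) - (y : Amb d)), ?_⟩
      rw [antipodalDeformation, ← stretch_zero_one (offDiag_eq.subset hp)]
      norm_num
  fixed := by
    rintro t - ⟨p, hp⟩ ⟨x, rfl⟩
    exact Subtype.ext (stretch_antipodal _ x one_pos)

theorem antipodalDeformation_apply (t : ℝ) (p : offDiag d) (x y : Sph d)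
    (h : (p : Sym2 (Sph d)) = s(x, y)) :
    ∃ xt yt : Sph d,
      (xt : Amb d) = ‖(1 - t) • x.1 - t • y.1‖⁻¹ • ((1 - t) • x.1 - t • y.1) ∧
      (yt : Amb d) = ‖(1 - t) • y.1 - t • x.1‖⁻¹ • ((1 - t) • y.1 - t • x.1) ∧
      (antipodalDeformation t p : Sym2 (Sph d)) = s(xt, yt) := by
  have hxy : inner ℝ (x : Amb d) y < 1 := by
    have := offDiag_eq.subset p.2
    rwa [h] at this
  refine ⟨radial ((1 - t) • x.1 - t • y.1), radial ((1 - t) • y.1 - t • x.1),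
    coe_radial (smul_sub_smul_sph_ne_zero hxy t),
    coe_radial (smul_sub_smul_sph_ne_zero (by rwa [real_inner_comm]) t), ?_⟩
  exact (congrArg (stretch (1 - 2 * t) 1) h).trans (stretch_one_eq t x y)

/-- The antipodal pair in which a line meets the sphere. -/
def antipodalPairOfLine : RealProj d → Sym2 (Sph d) :=
  Projectivization.lift (fun v => s(radial (v : Amb d), -radial (v : Amb d))) (by
    rintro ⟨a, ha⟩ ⟨b, hb⟩ t (rfl : a = t • b)
    dsimp only
    have ht : t ≠ 0 := (smul_ne_zero_iff.1 ha).1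
    rcases ht.lt_or_gt with h | h
    · rw [← neg_smul_neg, radial_smul (neg_pos.2 h), radial_neg hb, neg_neg, Sym2.eq_swap]
    · rw [radial_smul h])

theorem antipodalPairOfLine_mk (v : Amb d) (hv : v ≠ 0) :
    antipodalPairOfLine (Projectivization.mk ℝ v hv) = s(radial v, -radial v) := rfl

theorem continuous_antipodalPairOfLine : Continuous (antipodalPairOfLine (d := d)) := by
  refine continuous_coinduced_dom.2 ?_
  have h : Continuous fun v : {v : Amb d // v ≠ 0} => radial (v : Amb d) :=
    continuous_radial_comp continuous_subtype_val fun v => v.2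
  exact continuous_sym2Mk h (continuous_neg.comp h)

theorem symInner_antipodalPair (x : Sph d) : symInner s(x, -x) = -1 := by
  rw [symInner_mk, coe_neg_sphere, inner_neg_right, real_inner_self_eq_norm_sq, norm_coe_sph,
    one_pow]

theorem symInner_antipodalPairOfLine (l : RealProj d) : symInner (antipodalPairOfLine l) = -1 := by
  induction l using Projectivization.ind with
  | h v hv => rw [antipodalPairOfLine_mk, symInner_antipodalPair]

theorem continuous_projectivizationMk {T : Type*} [TopologicalSpace T] {f : T → Amb d}
    (hf : Continuous f) (h : ∀ t, f t ≠ 0) :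
    Continuous fun t => (Projectivization.mk ℝ (f t) (h t) : RealProj d) :=
  continuous_coinduced_rng.comp (hf.subtype_mk h)

/-- The line through the difference of the two points of an off-diagonal pair. -/
def lineOfPair : C(symInner (d := d) ⁻¹' Set.Iio 1, RealProj d) :=
  sym2LiftOn _ ⟨fun z => Projectivization.mk ℝ ((z.1.1 : Amb d) - (z.1.2 : Amb d))
      (sub_sph_ne_zero z.2),
    continuous_projectivizationMk (by fun_prop) _⟩ (by
      intro x y h h'
      refine (Projectivization.mk_eq_mk_iff' ℝ _ _ _ _).2 ⟨-1, ?_⟩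
      simp)

theorem lineOfPair_mk (x y : Sph d) (h : s(x, y) ∈ symInner (d := d) ⁻¹' Set.Iio 1) :
    lineOfPair ⟨s(x, y), h⟩ =
      Projectivization.mk ℝ ((x : Amb d) - (y : Amb d)) (sub_sph_ne_zero h) :=
  sym2LiftOn_mk _ _ _ x y h

theorem antipodalPairOfLine_mem (l : RealProj d) :
    antipodalPairOfLine l ∈ symInner (d := d) ⁻¹' Set.Iio 1 := by
  rw [Set.mem_preimage, symInner_antipodalPairOfLine, Set.mem_Iio]
  norm_num

/-- `antipodalPairOfLine` as a continuous map into the off-diagonal pairs. -/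
def lineToPair : C(RealProj d, symInner (d := d) ⁻¹' Set.Iio 1) :=
  ⟨fun l => ⟨antipodalPairOfLine l, antipodalPairOfLine_mem l⟩,
    continuous_antipodalPairOfLine.subtype_mk _⟩

/-- Lines correspond to antipodal pairs, and these are a deformation retract of the off-diagonal
pairs. -/
def realProjHomotopyEquiv : RealProj d ≃ₕ (symInner (d := d) ⁻¹' Set.Iio 1) where
  toFun := lineToPair
  invFun := lineOfPair
  left_inv := by
    have : lineOfPair.comp lineToPair = ContinuousMap.id (RealProj d) := by
      ext1 l
      induction l using Projectivization.ind with
      | h v hv =>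
        refine (lineOfPair_mk (radial v) (-radial v) _).trans
          ((Projectivization.mk_eq_mk_iff' ℝ _ _ _ _).2 ⟨2 * ‖v‖⁻¹, ?_⟩)
        rw [coe_neg_sphere, coe_radial hv]
        module
    rw [this]
  right_inv := by
    refine homotopic_id_of_stretch (J := Set.Iio 1) (a := fun z => 1 - z.1) (b := fun _ => 1)
      (by fun_prop) continuousOn_const (by simp) (by simp)
      (fun t s hs hs' => stretchDenom_one_pos _ hs'.1 hs)
      (fun t s hs hs' => stretch_one_quotient_lt_one _ hs'.1 hs) _ ?_
    rintro ⟨p, hp⟩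
    induction p using Sym2.ind with
    | _ x y =>
      have h0 : (1 : ℝ) - ((1 : unitInterval) : ℝ) = 0 := by simp
      refine (congrArg antipodalPairOfLine (lineOfPair_mk x y hp)).trans ?_
      simp only [h0]
      exact (stretch_zero_one hp).symm

end OffDiagonal

/-! ### Neighborhoods of the diagonal -/

section DiagonalNeighborhood

variable {d : ℕ}

/-- The midpoint of a pair of points that are not antipodal. -/
def midpointOfPair {c : ℝ} (hc : -1 < c) : C(symInner (d := d) ⁻¹' Set.Ioi c, Sph d) :=
  sym2LiftOn _ ⟨fun z => radial ((z.1.1 : Amb d) + (z.1.2 : Amb d)),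
    continuous_radial_comp (by fun_prop) fun z => add_sph_ne_zero (hc.trans z.2)⟩ (by
      intro x y h h'
      exact congrArg radial (add_comm (x : Amb d) (y : Amb d)))

theorem midpointOfPair_mk {c : ℝ} (hc : -1 < c) (x y : Sph d)
    (h : s(x, y) ∈ symInner (d := d) ⁻¹' Set.Ioi c) :
    midpointOfPair hc ⟨s(x, y), h⟩ = radial ((x : Amb d) + (y : Amb d)) :=
  sym2LiftOn_mk _ _ _ x y h

theorem diag_mem {c : ℝ} (hc : c < 1) (x : Sph d) : s(x, x) ∈ symInner (d := d) ⁻¹' Set.Ioi c := by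
  rw [Set.mem_preimage, symInner_mk, real_inner_self_eq_norm_sq, norm_coe_sph, one_pow]
  exact hc

/-- The diagonal embedding of the sphere into a neighborhood of the diagonal. -/
def diagEmbedding {c : ℝ} (hc : c < 1) : C(Sph d, symInner (d := d) ⁻¹' Set.Ioi c) :=
  ⟨fun x => ⟨s(x, x), diag_mem hc x⟩, (continuous_sym2Mk continuous_id continuous_id).subtype_mk _⟩

theorem stretch_one_zero (x y : Sph d) : stretch 1 0 s(x, y) =
    s(radial ((x : Amb d) + (y : Amb d)), radial ((x : Amb d) + (y : Amb d))) := by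
  rw [stretch_mk, zero_smul, one_smul, add_zero, sub_zero]

/-- The diagonal embedding into the pairs with inner product `> c` is a homotopy equivalence: two
points that are not antipodal can be moved simultaneously to their midpoint, which never decreases
their inner product. -/
def diagHomotopyEquiv {c : ℝ} (hc : -1 < c) (hc' : c < 1) :
    Sph d ≃ₕ (symInner (d := d) ⁻¹' Set.Ioi c) where
  toFun := diagEmbedding hc'
  invFun := midpointOfPair hc
  left_inv := by
    have : (midpointOfPair hc).comp (diagEmbedding hc') = ContinuousMap.id (Sph d) := by
      ext1 x
      refine (midpointOfPair_mk hc x x _).trans ?_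
      rw [← two_smul ℝ (x : Amb d), radial_smul two_pos, radial_coe]
      rfl
    rw [this]
  right_inv := by
    have hpos : ∀ (b s : ℝ), c < s → s ≤ 1 → 0 < stretchDenom 1 b s := by
      intro b s hs hs'
      have : 0 ≤ b ^ 2 * (1 - s) := mul_nonneg (sq_nonneg _) (by linarith)
      rw [stretchDenom]
      linarith
    refine homotopic_id_of_stretch (J := Set.Ioi c) (a := fun _ => 1) (b := fun z => 1 - z.1)
      continuousOn_const (by fun_prop) (by simp) (by simp) (fun t s hs hs' => hpos _ s hs hs'.2) ?_ _ ?_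
    · intro t s hs hs'
      refine lt_of_lt_of_le hs ((le_div_iff₀ (hpos _ s hs hs'.2)).2 ?_)
      rw [stretchDenom]
      have h1 : (1 - (t : ℝ)) ^ 2 ≤ 1 := by
        have := t.2.1
        have := t.2.2
        exact pow_le_one₀ (by linarith) (by linarith)
      -- The difference of the two sides is `(1 - b ^ 2) (1 - s ^ 2)` with `b = 1 - t`.
      have h2 : 0 ≤ (1 - (1 - (t : ℝ)) ^ 2) * ((1 - s) * (1 + s)) :=
        mul_nonneg (by linarith) (mul_nonneg (by linarith [hs'.2]) (by linarith [hs'.1]))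
      linear_combination h2
    · rintro ⟨p, hp⟩
      induction p using Sym2.ind with
      | _ x y =>
        have h0 : (1 : ℝ) - ((1 : unitInterval) : ℝ) = 0 := by simp
        refine (congrArg (fun z => s(z, z)) (midpointOfPair_mk hc x y hp)).trans ?_
        simp only [h0]
        exact (stretch_one_zero x y).symm

end DiagonalNeighborhood

/-! ### Distinct nearby points and tangent lines -/

section PuncturedNeighborhood

variable {d : ℕ}

/-- The unit vector in the direction of a nonzero tangent vector of the sphere. -/
def unitAmbientVec (w : TangentBundle (𝓡 d) (Sph d)) : Amb d :=
  ‖ambientVec w‖⁻¹ • ambientVec w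

theorem norm_unitAmbientVec {w : TangentBundle (𝓡 d) (Sph d)} (h : w.2 ≠ 0) :
    ‖unitAmbientVec w‖ = 1 := norm_smul_inv_norm (𝕜 := ℝ) (ambientVec_ne_zero h)

theorem inner_unitAmbientVec (w : TangentBundle (𝓡 d) (Sph d)) (a : ℝ) :
    inner ℝ (w.1 : Amb d) (a • unitAmbientVec w) = 0 := by
  rw [unitAmbientVec, real_inner_smul_right, real_inner_smul_right, inner_ambientVec, mul_zero,
    mul_zero]

theorem norm_sq_smul_unitAmbientVec {w : TangentBundle (𝓡 d) (Sph d)} (h : w.2 ≠ 0) (a : ℝ) :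
    ‖a • unitAmbientVec w‖ ^ 2 = a ^ 2 := by
  rw [norm_smul, norm_unitAmbientVec h, mul_one, Real.norm_eq_abs, sq_abs]

theorem norm_sq_add_unitAmbientVec_pos (w : TangentBundle (𝓡 d) (Sph d)) (a : ℝ) :
    0 < ‖(w.1 : Amb d)‖ ^ 2 + ‖a • unitAmbientVec w‖ ^ 2 := by
  rw [norm_coe_sph]
  positivity

/-- A nonzero tangent vector at `m` with direction `u` determines the pair of points in the
directions `m + a u` and `m - a u`. -/
def pairOfTangent (a : ℝ) (w : TangentBundle (𝓡 d) (Sph d)) : Sym2 (Sph d) :=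
  s(radial ((w.1 : Amb d) + a • unitAmbientVec w), radial ((w.1 : Amb d) - a • unitAmbientVec w))

theorem symInner_pairOfTangent {w : TangentBundle (𝓡 d) (Sph d)} (h : w.2 ≠ 0) (a : ℝ) :
    symInner (pairOfTangent a w) = (1 - a ^ 2) / (1 + a ^ 2) := by
  rw [pairOfTangent, symInner_mk, inner_radial_add_sub (inner_unitAmbientVec w a)
    (norm_sq_add_unitAmbientVec_pos w a), norm_sq_smul_unitAmbientVec h, norm_coe_sph, one_pow]

theorem pairOfTangent_smul (a : ℝ) (w : TangentBundle (𝓡 d) (Sph d)) (c : ℝˣ) :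
    pairOfTangent a ⟨w.1, (c : ℝ) • w.2⟩ = pairOfTangent a w := by
  have h1 : ambientVec ⟨w.1, (c : ℝ) • w.2⟩ = (c : ℝ) • ambientVec w := ambientVec_smul _ _ _
  have h2 : unitAmbientVec ⟨w.1, (c : ℝ) • w.2⟩ = (|(c : ℝ)|⁻¹ * c) • unitAmbientVec w := by
    rw [unitAmbientVec, h1, norm_smul, Real.norm_eq_abs, unitAmbientVec]
    module
  rcases c.ne_zero.lt_or_gt with h | h
  · have h3 : |(c : ℝ)|⁻¹ * c = -1 := by
      rw [abs_of_neg h, inv_neg, neg_mul, inv_mul_cancel₀ c.ne_zero]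
    rw [pairOfTangent, h2, h3, neg_one_smul, smul_neg, sub_neg_eq_add, ← sub_eq_add_neg,
      Sym2.eq_swap, pairOfTangent]
  · have h3 : |(c : ℝ)|⁻¹ * c = 1 := by
      rw [abs_of_pos h, inv_mul_cancel₀ c.ne_zero]
    rw [pairOfTangent, h2, h3, one_smul, pairOfTangent]

/-- `pairOfTangent` depends only on the line spanned by the tangent vector. -/
def pairOfTangentLine (a : ℝ) : ProjTangentBundle (𝓡 d) (Sph d) → Sym2 (Sph d) :=
  Quotient.lift (fun w => pairOfTangent a w.1) (by
    rintro ⟨v, hv⟩ ⟨w, hw⟩ ⟨c, hc⟩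
    dsimp only at hc ⊢
    rw [hc, pairOfTangent_smul])

theorem continuous_pairOfTangentLine (a : ℝ) : Continuous (pairOfTangentLine (d := d) a) := by
  have hF : Continuous fun w : {v : TangentBundle (𝓡 d) (Sph d) // v.2 ≠ 0} => ambientVec w.1 :=
    continuous_ambientVec.comp continuous_subtype_val
  have hu : Continuous fun w : {v : TangentBundle (𝓡 d) (Sph d) // v.2 ≠ 0} =>
      unitAmbientVec w.1 :=
    (hF.norm.inv₀ fun w => norm_ne_zero_iff.2 (ambientVec_ne_zero w.2)).smul hF
  have hp : Continuous fun w : {v : TangentBundle (𝓡 d) (Sph d) // v.2 ≠ 0} =>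
      (w.1.1 : Amb d) :=
    continuous_subtype_val.comp
      ((FiberBundle.continuous_proj (EuclideanSpace ℝ (Fin d)) (TangentSpace (𝓡 d))).comp
        continuous_subtype_val)
  refine Continuous.quotient_lift (continuous_sym2Mk (continuous_radial_comp
    (hp.add (hu.const_smul a)) fun w => ?_) (continuous_radial_comp
    (hp.sub (hu.const_smul a)) fun w => ?_)) _
  · exact add_ne_zero_of_orthogonal (inner_unitAmbientVec _ a) (norm_sq_add_unitAmbientVec_pos _ a)
  · exact sub_ne_zero_of_orthogonal (inner_unitAmbientVec _ a) (norm_sq_add_unitAmbientVec_pos _ a)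

theorem symInner_pairOfTangentLine (a : ℝ) (l : ProjTangentBundle (𝓡 d) (Sph d)) :
    symInner (pairOfTangentLine a l) = (1 - a ^ 2) / (1 + a ^ 2) := by
  induction l using Quotient.ind with
  | _ w => exact symInner_pairOfTangent w.2 a

theorem inner_midpoint_sub {x y : Sph d} (h : -1 < inner ℝ (x : Amb d) y) :
    inner ℝ (radial ((x : Amb d) + (y : Amb d)) : Amb d) ((x : Amb d) - (y : Amb d)) = 0 := by
  rw [coe_radial (add_sph_ne_zero h), real_inner_smul_left, inner_add_sub_sph, mul_zero]

/-- The line spanned by a nonzero tangent vector. -/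
def tangentLine (w : TangentBundle (𝓡 d) (Sph d)) (h : w.2 ≠ 0) :
    ProjTangentBundle (𝓡 d) (Sph d) :=
  Quotient.mk (tangentLineSetoid (𝓡 d) (Sph d)) ⟨w, h⟩

theorem tangentLine_tangentOfAmbient_eq {m m' : Sph d} {u v : Amb d} (hm : m = m')
    (hu : (tangentOfAmbient m u).2 ≠ 0) (hv : (tangentOfAmbient m' v).2 ≠ 0) (c : ℝˣ)
    (h : v = (c : ℝ) • u) :
    tangentLine _ hu = tangentLine _ hv := by
  subst hm h
  exact Quotient.sound ⟨c, tangentOfAmbient_smul m c u⟩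

/-- A pair of points that are neither equal nor antipodal determines a tangent line at its
midpoint `m`: the difference of the two points is orthogonal to `m`. -/
def tangentLineOfPair {c : ℝ} (hc : -1 < c) :
    C(symInner (d := d) ⁻¹' Set.Ioo c 1, ProjTangentBundle (𝓡 d) (Sph d)) :=
  sym2LiftOn _ ⟨fun z => tangentLine (tangentOfAmbient (radial ((z.1.1 : Amb d) + (z.1.2 : Amb d)))
      ((z.1.1 : Amb d) - (z.1.2 : Amb d)))
      (tangentOfAmbient_ne_zero (inner_midpoint_sub (hc.trans z.2.1)) (sub_sph_ne_zero z.2.2)),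
    continuous_quot_mk.comp ((continuous_tangentOfAmbient (continuous_radial_comp (by fun_prop)
      fun z => add_sph_ne_zero (hc.trans z.2.1)) (by fun_prop)).subtype_mk _)⟩ (by
      intro x y h h'
      exact tangentLine_tangentOfAmbient_eq (by rw [add_comm]) _ _ (-1) (by simp))

theorem tangentLineOfPair_mk {c : ℝ} (hc : -1 < c) (x y : Sph d)
    (h : s(x, y) ∈ symInner (d := d) ⁻¹' Set.Ioo c 1) :
    tangentLineOfPair hc ⟨s(x, y), h⟩ =
      tangentLine
        (tangentOfAmbient (radial ((x : Amb d) + (y : Amb d))) ((x : Amb d) - (y : Amb d)))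
        (tangentOfAmbient_ne_zero (inner_midpoint_sub (hc.trans h.1)) (sub_sph_ne_zero h.2)) :=
  sym2LiftOn_mk _ _ _ x y h

theorem tangentLine_congr {w w' : TangentBundle (𝓡 d) (Sph d)} (h : w = w') (hw : w.2 ≠ 0)
    (hw' : w'.2 ≠ 0) : tangentLine w hw = tangentLine w' hw' := by
  subst h
  rfl

theorem tangentLineOfPair_pairOfTangentLine {c a : ℝ} (hc : -1 < c) (ha : 0 < a)
    (l : ProjTangentBundle (𝓡 d) (Sph d))
    (h : pairOfTangentLine a l ∈ symInner (d := d) ⁻¹' Set.Ioo c 1) :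
    tangentLineOfPair hc ⟨pairOfTangentLine a l, h⟩ = l := by
  induction l using Quotient.ind with
  | _ w =>
    obtain ⟨w, hw⟩ := w
    have hF : ‖ambientVec w‖ ≠ 0 := norm_ne_zero_iff.2 (ambientVec_ne_zero hw)
    have hpos := norm_sq_add_unitAmbientVec_pos w a
    have horth := inner_unitAmbientVec w a
    have hN := Real.sqrt_pos.2 hpos
    have hx := coe_radial_add horth hpos
    have hy := coe_radial_sub horth hpos
    set N := √(‖(w.1 : Amb d)‖ ^ 2 + ‖a • unitAmbientVec w‖ ^ 2)
    refine (tangentLineOfPair_mk hc _ _ h).trans ?_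
    have hm : radial ((radial ((w.1 : Amb d) + a • unitAmbientVec w) : Amb d) +
        (radial ((w.1 : Amb d) - a • unitAmbientVec w) : Amb d)) = w.1 := by
      rw [hx, hy, ← smul_add, add_add_sub_cancel, ← two_smul ℝ (w.1 : Amb d), smul_smul,
        radial_smul (by positivity), radial_coe]
    have hv : (radial ((w.1 : Amb d) + a • unitAmbientVec w) : Amb d) -
        (radial ((w.1 : Amb d) - a • unitAmbientVec w) : Amb d) =
        (N⁻¹ * 2 * a * ‖ambientVec w‖⁻¹) • ambientVec w := by
      rw [hx, hy, unitAmbientVec]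
      module
    have hk : N⁻¹ * 2 * a * ‖ambientVec w‖⁻¹ ≠ 0 := by positivity
    have hw' : (tangentOfAmbient w.1 (ambientVec w)).2 ≠ 0 :=
      tangentOfAmbient_ne_zero (inner_ambientVec w) (ambientVec_ne_zero hw)
    exact (tangentLine_tangentOfAmbient_eq hm.symm hw' _ (Units.mk0 _ hk) hv).symm.trans
      (tangentLine_congr (tangentOfAmbient_ambientVec w) _ hw)

theorem pairOfTangentLine_tangentLineOfPair {c : ℝ} (hc : -1 < c) (a : ℝ)
    (p : symInner (d := d) ⁻¹' Set.Ioo c 1) :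
    pairOfTangentLine a (tangentLineOfPair hc p) =
      stretch (√(2 + 2 * symInner p.1))⁻¹ (a / √(2 - 2 * symInner p.1)) p.1 := by
  obtain ⟨p, hp⟩ := p
  induction p using Sym2.ind with
  | _ x y =>
    have hx : -1 < inner ℝ (x : Amb d) y := hc.trans hp.1
    refine (congrArg (pairOfTangentLine a) (tangentLineOfPair_mk hc x y hp)).trans ?_
    have hm := tangentOfAmbient_proj (radial ((x : Amb d) + (y : Amb d)))
      ((x : Amb d) - (y : Amb d))
    change pairOfTangent a _ = _
    rw [pairOfTangent, unitAmbientVec, ambientVec_tangentOfAmbient (inner_midpoint_sub hx), hm,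
      coe_radial (add_sph_ne_zero hx), smul_smul, stretch_mk, symInner_mk, ← norm_add_sph_sq,
      ← norm_sub_sph_sq, Real.sqrt_sq (norm_nonneg _), Real.sqrt_sq (norm_nonneg _),
      div_eq_mul_inv]

/-- Multiplied by the lengths `P = √(2 + 2 s)` and `Q = √(2 - 2 s)` of the sum and the difference
of the two points, the coefficients of the homotopy from `(1, 1)` to `(1 / P, a / Q)` become the
affine interpolations `A` from `P` to `1` and `B` from `Q` to `a`. The condition that the inner
product stays above `c` is the linear inequality `√(1 + c) B < √(1 - c) A`. -/
theorem exists_stretch_lengths {c a : ℝ} (hac : (1 + c) * a ^ 2 < 1 - c) (ha : 0 < a)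
    {t s : ℝ} (ht : t ∈ Set.Icc (0 : ℝ) 1) (hc : -1 < c) (hs : c < s) (hs' : s < 1) :
    ∃ A B : ℝ, 0 < A ∧ 0 < B ∧ (1 + c) * B ^ 2 < (1 - c) * A ^ 2 ∧
      (1 - t + t * (√(2 + 2 * s))⁻¹) ^ 2 * (1 + s) = A ^ 2 / 2 ∧
      (1 - t + t * (a / √(2 - 2 * s))) ^ 2 * (1 - s) = B ^ 2 / 2 := by
  have hP := Real.sqrt_pos.2 (show 0 < 2 + 2 * s by linarith)
  have hQ := Real.sqrt_pos.2 (show 0 < 2 - 2 * s by linarith)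
  have hP2 := Real.sq_sqrt (show 0 ≤ 2 + 2 * s by linarith)
  have hQ2 := Real.sq_sqrt (show 0 ≤ 2 - 2 * s by linarith)
  have hk2 := Real.sq_sqrt (show 0 ≤ 1 + c by linarith)
  have hl2 := Real.sq_sqrt (show 0 ≤ 1 - c by linarith)
  have hk := Real.sqrt_nonneg (1 + c)
  have hl := Real.sqrt_nonneg (1 - c)
  set P := √(2 + 2 * s)
  set Q := √(2 - 2 * s)
  set k := √(1 + c)
  set l := √(1 - c)
  have h1 : k * Q < l * P := by
    refine lt_of_pow_lt_pow_left₀ 2 (by positivity) ?_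
    rw [mul_pow, mul_pow, hk2, hl2, hP2, hQ2]
    linarith
  have h2 : k * a < l * 1 := by
    refine lt_of_pow_lt_pow_left₀ 2 (by positivity) ?_
    rw [mul_pow, hk2, mul_one, hl2]
    exact hac
  have interp : ∀ {u v u' v' : ℝ}, u < u' → v < v' →
      (1 - t) * u + t * v < (1 - t) * u' + t * v' := by
    intro u v u' v' hu hv
    rcases ht.2.eq_or_lt with rfl | ht1
    · linarith
    · exact add_lt_add_of_lt_of_le (mul_lt_mul_of_pos_left hu (by linarith))
        (mul_le_mul_of_nonneg_left hv.le ht.1)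
  have hA : 0 < (1 - t) * P + t * 1 := by
    have := interp hP one_pos
    linarith
  have hB : 0 < (1 - t) * Q + t * a := by
    have := interp hQ ha
    linarith
  refine ⟨_, _, hA, hB, ?_, ?_, ?_⟩
  · rw [← hk2, ← hl2, ← mul_pow, ← mul_pow]
    refine pow_lt_pow_left₀ ?_ (mul_nonneg hk hB.le) two_ne_zero
    linarith [interp h1 h2]
  · rw [show 1 + s = P ^ 2 / 2 by rw [hP2]; ring]
    field_simp
  · rw [show 1 - s = Q ^ 2 / 2 by rw [hQ2]; ring]
    field_simp

theorem pairOfTangentLine_mem {c a : ℝ} (ha : 0 < a) (hac : (1 + c) * a ^ 2 < 1 - c)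
    (l : ProjTangentBundle (𝓡 d) (Sph d)) :
    pairOfTangentLine a l ∈ symInner (d := d) ⁻¹' Set.Ioo c 1 := by
  have h1 : 0 < 1 + a ^ 2 := by positivity
  have h2 : 0 < a ^ 2 := by positivity
  rw [Set.mem_preimage, symInner_pairOfTangentLine, Set.mem_Ioo, lt_div_iff₀ h1, div_lt_one h1]
  constructor <;> linarith

/-- `pairOfTangentLine` as a continuous map into the pairs of distinct points with inner product
`> c`. -/
def tangentLineToPair {c a : ℝ} (ha : 0 < a) (hac : (1 + c) * a ^ 2 < 1 - c) :
    C(ProjTangentBundle (𝓡 d) (Sph d), symInner (d := d) ⁻¹' Set.Ioo c 1) :=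
  ⟨fun l => ⟨pairOfTangentLine a l, pairOfTangentLine_mem ha hac l⟩,
    (continuous_pairOfTangentLine a).subtype_mk _⟩

/-- The pairs of distinct points with inner product `> c` are homotopy equivalent to the tangent
lines. Here `a` is the tangent of half the angle of the pairs assigned to tangent lines. -/
def tangentLineHomotopyEquiv {c a : ℝ} (hc : -1 < c) (ha : 0 < a)
    (hac : (1 + c) * a ^ 2 < 1 - c) :
    (symInner (d := d) ⁻¹' Set.Ioo c 1) ≃ₕ ProjTangentBundle (𝓡 d) (Sph d) where
  toFun := tangentLineOfPair hc
  invFun := tangentLineToPair ha hac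
  right_inv := by
    have : (tangentLineOfPair hc).comp (tangentLineToPair ha hac) =
        ContinuousMap.id (ProjTangentBundle (𝓡 d) (Sph d)) := by
      ext1 l
      exact tangentLineOfPair_pairOfTangentLine hc ha l _
    rw [this]
  left_inv := by
    refine homotopic_id_of_stretch (J := Set.Ioo c 1) (a := fun z => 1 - z.1 + z.1 * (√(2 + 2 * z.2))⁻¹)
      (b := fun z => 1 - z.1 + z.1 * (a / √(2 - 2 * z.2))) ?_ ?_ (by simp) (by simp) ?_ ?_ _ ?_
    · refine ContinuousOn.add (by fun_prop) (ContinuousOn.mul (by fun_prop)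
        (ContinuousOn.inv₀ (by fun_prop) ?_))
      rintro ⟨t, s⟩ ⟨-, hs⟩
      exact (Real.sqrt_pos.2 (by linarith [hs.1])).ne'
    · refine ContinuousOn.add (by fun_prop) (ContinuousOn.mul (by fun_prop)
        (ContinuousOn.div continuousOn_const (by fun_prop) ?_))
      rintro ⟨t, s⟩ ⟨-, hs⟩
      exact (Real.sqrt_pos.2 (by linarith [hs.2])).ne'
    · intro t s hs hs'
      obtain ⟨A, B, hA, hB, h, eA, eB⟩ := exists_stretch_lengths hac ha t.2 hc hs.1 hs.2
      rw [stretchDenom, eA, eB]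
      positivity
    · intro t s hs hs'
      obtain ⟨A, B, hA, hB, h, eA, eB⟩ := exists_stretch_lengths hac ha t.2 hc hs.1 hs.2
      have hpos : 0 < A ^ 2 + B ^ 2 := by positivity
      have hB2 : 0 < B ^ 2 := by positivity
      rw [stretchDenom, eA, eB, ← sub_div, ← add_div, div_div_div_cancel_right₀ two_ne_zero,
        Set.mem_Ioo, lt_div_iff₀ hpos, div_lt_one hpos]
      constructor <;> linarith
    · intro p
      refine (pairOfTangentLine_tangentLineOfPair hc a p).trans ?_
      simp

end PuncturedNeighborhood

/-! ### The homotopy types of the sets of pairs -/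

theorem exists_sq_mul_lt {c : ℝ} (hc : -1 < c) (hc' : c < 1) :
    ∃ a : ℝ, 0 < a ∧ (1 + c) * a ^ 2 < 1 - c := by
  have h1 : 0 < 1 + c := by linarith
  have h2 : 0 < (1 - c) / (1 + c) / 2 := div_pos (div_pos (by linarith) h1) two_pos
  refine ⟨√((1 - c) / (1 + c) / 2), Real.sqrt_pos.2 h2, ?_⟩
  rw [Real.sq_sqrt h2.le]
  field_simp
  linarith

theorem lemma2p1 (n : ℕ) :
    -- the deformation retraction of the complement `V` of the diagonal onto the antipodal pairs
    (∃ ρ : ℝ → offDiag (2 * n) → offDiag (2 * n),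
      IsDeformationRetraction {p : offDiag (2 * n) | p.1 ∈ antipodalPairs (2 * n)} (1 / 2) ρ ∧
      ∀ t ∈ Set.Icc (0 : ℝ) (1 / 2), ∀ (p : offDiag (2 * n)) (x y : Sph (2 * n)),
        (p : Sym2 (Sph (2 * n))) = s(x, y) →
        ∃ xt yt : Sph (2 * n),
          (xt : EuclideanSpace ℝ (Fin (2 * n + 1))) =
            ‖(1 - t) • x.1 - t • y.1‖⁻¹ • ((1 - t) • x.1 - t • y.1) ∧
          (yt : EuclideanSpace ℝ (Fin (2 * n + 1))) =
            ‖(1 - t) • y.1 - t • x.1‖⁻¹ • ((1 - t) • y.1 - t • x.1) ∧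
          (ρ t p : Sym2 (Sph (2 * n))) = s(xt, yt)) ∧
    -- the homotopy equivalence of `V` with `ℝP^{2n}`
    (∃ e : RealProj (2 * n) ≃ₕ offDiag (2 * n),
      ∀ x : Sph (2 * n), (e (lineThrough x) : Sym2 (Sph (2 * n))) = s(x, -x)) ∧
    -- the homotopy types of `U` and of `U ∩ V`, for all sufficiently small `ε`
    ∃ ε₀ : ℝ, 0 < ε₀ ∧ ∀ ε : ℝ, 0 < ε → ε < ε₀ →
      (∃ e : Sph (2 * n) ≃ₕ tubeNhd (2 * n) ε,
        ∀ x : Sph (2 * n), (e x : Sym2 (Sph (2 * n))) = s(x, x)) ∧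
      Nonempty ((tubeNhd (2 * n) ε ∩ offDiag (2 * n) : Set (Sym2 (Sph (2 * n)))) ≃ₕ
        ProjTangentBundle (𝓡 (2 * n)) (Sph (2 * n))) := by
  refine ⟨⟨antipodalDeformation, isDeformationRetraction_antipodalDeformation,
    fun t _ => antipodalDeformation_apply t⟩, ?_, 1, one_pos, fun ε hε hε' => ?_⟩
  · rw [offDiag_eq]
    refine ⟨realProjHomotopyEquiv, fun x => ?_⟩
    refine (antipodalPairOfLine_mk _ (coe_sph_ne_zero x)).trans ?_
    rw [radial_coe]
  · have hpos : 0 < √2 * ε := by positivity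
    have hpi : √2 * ε < Real.pi := by
      have h2 : √2 < 2 := (Real.sqrt_lt' two_pos).2 (by norm_num)
      nlinarith [Real.pi_gt_three, Real.sqrt_nonneg 2]
    have hc' : Real.cos (√2 * ε) < 1 := by
      have := Real.cos_lt_cos_of_nonneg_of_le_pi le_rfl hpi.le hpos
      rwa [Real.cos_zero] at this
    have hc : -1 < Real.cos (√2 * ε) := by
      have := Real.cos_lt_cos_of_nonneg_of_le_pi hpos.le le_rfl hpi
      rwa [Real.cos_pi] at this
    rw [tubeNhd_eq hε hpi.le, offDiag_eq, ← Set.preimage_inter, Set.Ioi_inter_Iio]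
    obtain ⟨a, ha, hac⟩ := exists_sq_mul_lt hc hc'
    exact ⟨⟨diagHomotopyEquiv hc hc', fun x => rfl⟩, ⟨tangentLineHomotopyEquiv hc ha hac⟩⟩

end
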